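/- Let $n,k,d$ be integers with $n\ge 2$, $1\le k\le n-1$ and $1\le d\le n-1$. **Setting.** In a storage network of $n$ nodes, single nodes fail one after another, and each failed node is replaced by a newcomer that contacts $d$ of the $n-1$ surviving nodes (its helpers). A *dynamic helper selection (DHS) scheme* $A$ chooses, at each time $\tau$, the set of $d$ helpers as a function of the nodes $F_1,\dots,F_\tau$ that failed at times $1,\dots,\tau$. For $\alpha,\beta\in[0,\infty]$, each finite failure sequence gives an *information flow graph*: each initial node and each newcomer $x$ is represented by an edge $x_{\mathrm{in}}\to x_{\mathrm{out}}$ of capacity $\alpha$; a source $s$ is joined to $x_{\mathrm{in}}$ for each initial $x$ by an edge of infinite capacity; for each newcomer $y$ and each of its $d$ helpers $x$ (in its incarnation at the time of the repair) there is an edge $x_{\mathrm{out}}\to y_{\mathrm{in}}$ of capacity $\beta$; and for every choice of $k$ of the $n$ finally active nodes there is a data collector, joined to their output vertices by edges of infinite capacity. Let $\mathcal G_A$ be the set of all information flow graphs that $A$ produces, let $\mathcal G=\bigcup_A\mathcal G_A$ (*blind helper selection*, BHS), and for a collection $\mathcal C$ let $m_{\mathcal C}(\alpha,\beta)$ be the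 smallest min-cut value between $s$ and $t$, over all graphs in $\mathcal C$ and all data collectors $t$. Put $$\Sigma(\alpha,\beta)=\sum_{i=0}^{k-1}\min\big((d-i)^+\beta,\ \alpha\big),\qquad (x)^+=\max(x,0).$$ **Family-plus scheme.** The *family scheme* on nodes $1,\dots,N$ ($N>d$): the first $\lfloor N/(N-d)\rfloor (N-d)$ nodes are cut into consecutive complete families of $N-d$ nodes, and the remaining nodes form the incomplete family; a node of a complete family is always helped by all nodes outside its family, a node of the incomplete family by nodes $1,\dots,d$. The *family-plus scheme* on $n$ nodes cuts the nodes into $\max(1,\lfloor n/(2d)\rfloor)$ consecutive groups, all of size $2d$ except possibly the last one, which takes all the remaining nodes, and applies the family scheme within each group. **Theorem.** For all $\alpha,\beta\in[0,\infty]$, $m_{\mathcal G}(\alpha,\beta)=\Sigma(\alpha,\beta)$. Consider the two conditions (i) $d=1$, $k=3$ and $n$ is odd; (ii) $k\le\left\lceil \frac{n}{n-d}\right\rceil$. *Converse.* If (i) or (ii) holds, then $m_{\mathcal G_A}(\alpha,\beta)=\Sigma(\alpha,\beta)$ for every DHS scheme $A$ and all $\alpha,\beta\in[0,\infty]$. In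 particular BHS is absolutely optimal: $m_{\mathcal G}(\alpha,\beta)\ge m_{\mathcal G_B}(\alpha,\beta)$ for every DHS scheme $B$ and all $\alpha,\beta$. *Achievability.* If neither (i) nor (ii) holds, then there are finite $\alpha,\beta>0$ such that the family-plus scheme $F^+$ satisfies $m_{\mathcal G_{F^+}}(\alpha,\beta)>\Sigma(\alpha,\beta)$. -/

import Mathlib

open scoped ENNReal NNReal

namespace DistributedStorage

/-- A dynamic helper selection scheme for `n` nodes and `d` helpers per repair.
Time is indexed from `0`: `helpers τ F` is the set of physical nodes that help the newcomer at
time `τ`, as a function of the nodes `F 0, …, F τ` that failed up to and including time `τ`.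
The helpers are `d` of the `n - 1` surviving nodes. -/
structure HelperScheme (n d : ℕ) where
  helpers : (τ : ℕ) → (Fin (τ + 1) → Fin n) → Finset (Fin n)
  card_helpers : ∀ τ F, (helpers τ F).card = d
  failed_notMem : ∀ τ F, F (Fin.last τ) ∉ helpers τ F

/-- A stationary helper selection scheme: each physical node has a fixed helper set. -/
structure StationaryScheme (n d : ℕ) where
  helperSet : Fin n → Finset (Fin n)
  card_helperSet : ∀ i, (helperSet i).card = d
  self_notMem : ∀ i, i ∉ helperSet i

/-- A stationary scheme, seen as a dynamic one. -/
def StationaryScheme.toHelperScheme {n d : ℕ} (A : StationaryScheme n d) : HelperScheme n d where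
  helpers τ F := A.helperSet (F (Fin.last τ))
  card_helpers _ _ := A.card_helperSet _
  failed_notMem _ _ := A.self_notMem _

/-- An information flow graph, given by the history that it depicts: `numRepairs` single failures,
each followed by the repair of the failed node with the help of `d` surviving nodes.
The vertices and the edge capacities are `IFG.Vertex` and `IFG.capacity`. -/
structure IFG (n d : ℕ) where
  numRepairs : ℕ
  failed : Fin numRepairs → Fin n
  helpers : Fin numRepairs → Finset (Fin n)
  card_helpers : ∀ l, (helpers l).card = d
  failed_notMem : ∀ l, failed l ∉ helpers l

/-- The storage nodes of an information flow graph: the `n` initial nodes (`Sum.inl`), and one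
newcomer for each repair (`Sum.inr`). -/
abbrev StorageNode (n T : ℕ) : Type := Fin n ⊕ Fin T

/-- The storage node that plays the role of each physical node (that is, the active one) after the
first `l` repairs, when `failed` lists the physical nodes that fail. -/
def activeNode {n T : ℕ} (failed : Fin T → Fin n) : ℕ → Fin n → StorageNode n T
  | 0, i => Sum.inl i
  | l + 1, i =>
    if h : l < T then
      if failed ⟨l, h⟩ = i then Sum.inr ⟨l, h⟩ else activeNode failed l i
    else activeNode failed l i

/-- The vertices: the source, an input and an output vertex for each storage node, and a data
collector for each choice of `k` of the `n` active nodes. -/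
inductive Vertex (n T k : ℕ) : Type
  | source : Vertex n T k
  | inp : StorageNode n T → Vertex n T k
  | out : StorageNode n T → Vertex n T k
  | collector : {S : Finset (Fin n) // S.card = k} → Vertex n T k
  deriving DecidableEq, Fintype

namespace IFG

variable {n d : ℕ} (G : IFG n d)

abbrev Vertex (k : ℕ) : Type := DistributedStorage.Vertex n G.numRepairs k

/-- The capacity of each edge (`0` if there is no edge): `∞` from the source to the initial nodes,
`α` from the input to the output of each storage node, `β` from the output of the helpers (those
that are active when the repair takes place) to the input of the newcomer, and `∞` from the output
of the `k` chosen finally active nodes to the data collector. -/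
noncomputable def capacity {k : ℕ} (α β : ℝ≥0∞) : G.Vertex k → G.Vertex k → ℝ≥0∞
  | .source, .inp (Sum.inl _) => ⊤
  | .inp x, .out y => if x = y then α else 0
  | .out x, .inp (Sum.inr l) => if ∃ i ∈ G.helpers l, activeNode G.failed l i = x then β else 0
  | .out x, .collector S => if ∃ i ∈ S.1, activeNode G.failed G.numRepairs i = x then ⊤ else 0
  | _, _ => 0

/-- The value of the cut `(U, Uᶜ)`. -/
noncomputable def cutValue {k : ℕ} (α β : ℝ≥0∞) (U : Finset (G.Vertex k)) : ℝ≥0∞ :=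
  ∑ u ∈ U, ∑ v ∈ Uᶜ, G.capacity α β u v

/-- The minimum cut value that separates the source from the data collector `t`. The infimum is
over the finite set of cuts, so that it is a minimum. -/
noncomputable def minCut {k : ℕ} (α β : ℝ≥0∞) (t : {S : Finset (Fin n) // S.card = k}) : ℝ≥0∞ :=
  ⨅ (U : Finset (G.Vertex k)) (_ : Vertex.source ∈ U ∧ Vertex.collector t ∉ U), G.cutValue α β U

end IFG

/-- The collection of all information flow graphs of the scheme `A`, over all finite failure
patterns. -/
def HelperScheme.ifgs {n d : ℕ} (A : HelperScheme n d) : Set (IFG n d) :=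
  {G | ∀ l : Fin G.numRepairs,
    G.helpers l = A.helpers l (fun j => G.failed (Fin.castLE (Nat.succ_le_of_lt l.isLt) j))}

/-- The information flow graphs of blind helper selection: the union over all schemes. -/
def blindIFGs (n d : ℕ) : Set (IFG n d) := ⋃ A : HelperScheme n d, A.ifgs

/-- The smallest min-cut value over all graphs of the collection and all data collectors. -/
noncomputable def minMinCut {n d : ℕ} (C : Set (IFG n d)) (k : ℕ) (α β : ℝ≥0∞) : ℝ≥0∞ :=
  ⨅ G ∈ C, ⨅ t : {S : Finset (Fin n) // S.card = k}, G.minCut α β t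

/-- Absolute optimality of a way of selecting helpers, which is given by its collection `C` of
information flow graphs: no dynamic helper selection scheme has a larger min-cut value, for any
`(α, β)`. -/
def IsAbsolutelyOptimal {n d : ℕ} (C : Set (IFG n d)) (k : ℕ) : Prop :=
  ∀ (B : HelperScheme n d) (α β : ℝ≥0∞), minMinCut B.ifgs k α β ≤ minMinCut C k α β

/-- The helper set of node `i` in the family helper selection scheme for the nodes
`0, …, N - 1`. Node `j` is in family number `j / (N - d)`; the families `0, …, N / (N - d) - 1` are
complete, and the remaining nodes form the incomplete family. A node of a complete family is helped
by all nodes outside its family, and a node of the incomplete family by the first `d` nodes. -/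
def familyHelpers (N d i : ℕ) : Finset ℕ :=
  if i < N / (N - d) * (N - d) then {j ∈ Finset.range N | j / (N - d) ≠ i / (N - d)}
  else Finset.range d

/-- The number of groups in the family-plus scheme. If `2 * d ∣ n` then all groups are regular,
of size `2 * d`; otherwise the last group is the remaining group, which has the smallest possible
size that is at least `2 * d + 1` (or is everything, if `n < 2 * d`). -/
def numGroups (n d : ℕ) : ℕ := max 1 (n / (2 * d))

/-- The group of node `i`. -/
def groupOf (n d i : ℕ) : ℕ := min (i / (2 * d)) (numGroups n d - 1)

/-- The number of nodes in group `b`. -/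
def groupSize (n d b : ℕ) : ℕ :=
  if b + 1 < numGroups n d then 2 * d else n - 2 * d * (numGroups n d - 1)

/-- The helper set of node `i` in the family-plus scheme for the nodes `0, …, n - 1`: the family
scheme is applied within the group of `i`, whose first node is `2 * d * groupOf n d i`. -/
def familyPlusHelpers (n d i : ℕ) : Finset ℕ :=
  (familyHelpers (groupSize n d (groupOf n d i)) d (i - 2 * d * groupOf n d i)).map
    (addLeftEmbedding (2 * d * groupOf n d i))

theorem familyHelpers_lt {N d i j : ℕ} (hd : d < N) (hj : j ∈ familyHelpers N d i) : j < N := by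
  unfold familyHelpers at hj
  split_ifs at hj
  · exact Finset.mem_range.1 (Finset.mem_filter.1 hj).1
  · exact (Finset.mem_range.1 hj).trans hd

theorem self_notMem_familyHelpers {N d i : ℕ} (hd : d < N) : i ∉ familyHelpers N d i := by
  unfold familyHelpers
  split_ifs with h
  · simp
  · have h1 := Nat.div_add_mod N (N - d)
    have h2 := Nat.mod_lt N (Nat.sub_pos_of_lt hd)
    rw [mul_comm] at h1
    simp only [Finset.mem_range]
    omega

theorem card_familyHelpers {N d i : ℕ} (hd : d < N) : (familyHelpers N d i).card = d := by
  unfold familyHelpers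
  split_ifs with h
  · have hm : 0 < N - d := Nat.sub_pos_of_lt hd
    have hq : i / (N - d) < N / (N - d) := (Nat.div_lt_iff_lt_mul hm).2 h
    have hle : (i / (N - d) + 1) * (N - d) ≤ N :=
      (Nat.mul_le_mul_right _ hq).trans (Nat.div_mul_le_self N (N - d))
    have hfam : {j ∈ Finset.range N | j / (N - d) = i / (N - d)}
        = Finset.Ico (i / (N - d) * (N - d)) ((i / (N - d) + 1) * (N - d)) := by
      ext j
      simp only [Finset.mem_filter, Finset.mem_range, Finset.mem_Ico]
      rw [Nat.div_eq_iff hm, Nat.add_mul]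
      rw [Nat.add_mul] at hle
      omega
    have hsum := Finset.card_filter_add_card_filter_not (s := Finset.range N)
      (fun j => j / (N - d) = i / (N - d))
    rw [hfam, Nat.card_Ico, Nat.add_mul, Finset.card_range] at hsum
    simp only [ne_eq]
    omega
  · simp

theorem lt_groupSize {n d : ℕ} (hd : 1 ≤ d) (hdn : d < n) (b : ℕ) : d < groupSize n d b := by
  unfold groupSize numGroups
  split_ifs
  · omega
  · rcases Nat.eq_zero_or_pos (n / (2 * d)) with h | h
    · simp [h, hdn]
    · have h1 := Nat.mul_div_le n (2 * d)
      rw [max_eq_right h, Nat.mul_sub]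
      have h2 : 2 * d * 1 ≤ 2 * d * (n / (2 * d)) := Nat.mul_le_mul_left _ h
      omega

theorem group_end_le (n d i : ℕ) :
    2 * d * groupOf n d i + groupSize n d (groupOf n d i) ≤ n := by
  have h1 : 2 * d * (n / (2 * d)) ≤ n := Nat.mul_div_le n (2 * d)
  have h3 : 2 * d * (numGroups n d - 1) ≤ n :=
    (Nat.mul_le_mul_left _ (by unfold numGroups; generalize n / (2 * d) = q; omega)).trans h1
  have h2 : groupOf n d i ≤ numGroups n d - 1 := min_le_right _ _
  unfold groupSize
  split_ifs with h
  · have h4 : 2 * d * (groupOf n d i + 1) ≤ 2 * d * (numGroups n d - 1) :=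
      Nat.mul_le_mul_left _ (by omega)
    rw [Nat.mul_add] at h4
    omega
  · have h5 : groupOf n d i = numGroups n d - 1 := by omega
    rw [h5]
    omega

theorem group_start_le (n d i : ℕ) : 2 * d * groupOf n d i ≤ i :=
  (Nat.mul_le_mul_left _ (min_le_left _ _)).trans (Nat.mul_div_le i (2 * d))

theorem familyPlusHelpers_lt {n d i : ℕ} (hd : 1 ≤ d) (hdn : d < n) {j : ℕ}
    (hj : j ∈ familyPlusHelpers n d i) : j < n := by
  obtain ⟨a, ha, rfl⟩ := Finset.mem_map.1 hj
  have h1 := familyHelpers_lt (lt_groupSize hd hdn _) ha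
  have h2 := group_end_le n d i
  simp only [addLeftEmbedding_apply]
  omega

/-- The family-plus helper selection scheme. -/
def familyPlusScheme (n d : ℕ) (hd : 1 ≤ d) (hdn : d < n) : StationaryScheme n d where
  helperSet i := (familyPlusHelpers n d i).attachFin
    (fun _ hj => familyPlusHelpers_lt hd hdn hj)
  card_helperSet i := by
    rw [Finset.card_attachFin, familyPlusHelpers, Finset.card_map,
      card_familyHelpers (lt_groupSize hd hdn _)]
  self_notMem i := by
    rw [Finset.mem_attachFin, familyPlusHelpers, Finset.mem_map]
    rintro ⟨a, ha, hai⟩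
    simp only [addLeftEmbedding_apply] at hai
    have h : (i : ℕ) - 2 * d * groupOf n d i = a := by omega
    rw [h] at ha
    exact self_notMem_familyHelpers (lt_groupSize hd hdn _) ha

end DistributedStorage

/-!
Let `W` be the set of storage nodes whose output vertices lie on the side of the data collector. The
cheapest cut with a given `W` costs `α` for each initial node in `W`, and `min (m * β) α` for each
newcomer in `W` with `m` helpers outside `W`. So a min-cut is the minimum of this cost over all sets
`W` that contain the `k` nodes chosen by the data collector (`IFG.le_minCut_iff`).

*Lower bound.* All helpers of a newcomer are older than it, so the `i`-th oldest element of `W`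
(counted from `0`) has at least `d - i` helpers outside `W`. As `W` has at least `k` elements, the
sum in the theorem is a lower bound for every information flow graph (`IFG.sum_le_minCut`). It is
attained if `k` newcomers help one another as much as possible.

*Converse.* Let every node fail once. Each newcomer lacks the help of at most `n - d - 1` of the older
newcomers. If `(k - 1) * (n - d) < n`, which says that `k ≤ ⌈n / (n - d)⌉`, a greedy choice from the
youngest newcomer downwards (`exists_chain`) gives `k` newcomers each of which is helped by all older
ones. For `d = 1`, the newcomers form trees, and a tree costs no more than the repair of its root; so
for `k = 3` a tree with three active nodes is enough. If all trees have at most two active nodes and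
`n` is odd, then some active node is alone in its tree; when it fails, its replacement joins another
tree, and the number of trees decreases. Hence a tree with three active nodes can be forced
(`exists_three_of_treeRoot`).

*Achievability.* Take `β = 1` and `α` larger than the lower bound. Costs are then natural numbers, so
it suffices that no `W` attains the lower bound. If `W` attains it, then `W` consists of newcomers,
the oldest `min k (d + 1)` of them help one another, and all helpers of the others are in `W`
(`IFG.exists_eq_inr_of_sum_natCost_le`). In the family-plus scheme, nodes that help one another are in
one group and in different families, and for `d ≥ 2` no group has that many families
(`exists_lt_minMinCut_familyPlus`). For `d = 1`, such a `W` is a tree that stays in one group, whereas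
a group has only two nodes, or three if `n` is odd (`exists_lt_minMinCut_familyPlus_one`).
-/

namespace DistributedStorage

/-! ### Active nodes and their order of creation -/

/-- The physical node that a storage node represents. -/
def physicalNode {n T : ℕ} (failed : Fin T → Fin n) : StorageNode n T → Fin n :=
  Sum.elim id failed

@[simp]
theorem physicalNode_activeNode {n T : ℕ} (failed : Fin T → Fin n) (l : ℕ) (i : Fin n) :
    physicalNode failed (activeNode failed l i) = i := by
  induction l with
  | zero => simp [activeNode, physicalNode]
  | succ l ih =>
    unfold activeNode
    split_ifs with h h1
    · simpa [physicalNode] using h1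
    · exact ih
    · exact ih

theorem activeNode_injective {n T : ℕ} (failed : Fin T → Fin n) (l : ℕ) :
    Function.Injective (activeNode failed l) :=
  Function.LeftInverse.injective (physicalNode_activeNode failed l)

theorem lt_of_activeNode_eq_inr {n T : ℕ} {failed : Fin T → Fin n} {l : ℕ} {i : Fin n} {j : Fin T}
    (h : activeNode failed l i = Sum.inr j) : (j : ℕ) < l := by
  induction l with
  | zero => simp [activeNode] at h
  | succ l ih =>
    unfold activeNode at h
    split_ifs at h with h1 h2
    · obtain rfl := Sum.inr.inj h
      simp
    · exact (ih h).trans (Nat.lt_succ_self l)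
    · exact (ih h).trans (Nat.lt_succ_self l)

/-- The position of a storage node in the order of creation, the initial nodes coming first. -/
def birth {n T : ℕ} : StorageNode n T → ℕ :=
  Sum.elim (fun i => (i : ℕ)) (fun l => n + l)

theorem birth_injective {n T : ℕ} : Function.Injective (birth (n := n) (T := T)) := by
  rintro (x | x) (y | y) h <;> simp only [birth, Sum.elim_inl, Sum.elim_inr] at h
  · rw [Fin.ext h]
  · omega
  · omega
  · rw [Fin.ext (Nat.add_left_cancel h)]

theorem birth_activeNode_lt {n T : ℕ} (failed : Fin T → Fin n) (l : Fin T) (i : Fin n) :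
    birth (activeNode failed l i) < birth (Sum.inr l : StorageNode n T) := by
  rcases h : activeNode failed l i with j | j
  · simp only [birth, Sum.elim_inl, Sum.elim_inr]; omega
  · have := lt_of_activeNode_eq_inr h
    simpa [birth] using this

/-- The elements of `W` that were created before `x`. -/
def olderIn {n T : ℕ} (W : Finset (StorageNode n T)) (x : StorageNode n T) :
    Finset (StorageNode n T) :=
  {y ∈ W | birth y < birth x}

/-- As `x` runs through `W`, the number of older elements of `W` runs through `0, …, #W - 1`. -/
theorem sum_card_olderIn {n T : ℕ} {M : Type*} [AddCommMonoid M] (a : ℕ → M)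
    (W : Finset (StorageNode n T)) :
    ∑ x ∈ W, a (olderIn W x).card = ∑ i ∈ Finset.range W.card, a i := by
  induction W using Finset.induction_on_max_value birth with
  | empty => simp
  | insert x s hx hmax ih =>
    rw [Finset.sum_insert hx, Finset.card_insert_of_notMem hx, Finset.sum_range_succ, ← ih,
      add_comm]
    have hlt : ∀ y ∈ s, birth y < birth x := fun y hy =>
      lt_of_le_of_ne (hmax y hy) fun h => hx (birth_injective h ▸ hy)
    congr 1
    · refine Finset.sum_congr rfl fun y hy => ?_
      have := hlt y hy
      rw [olderIn, Finset.filter_insert, if_neg (by omega)]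
      rfl
    · rw [olderIn, Finset.filter_insert, if_neg (lt_irrefl _), Finset.filter_true_of_mem hlt]

theorem card_filter_card_olderIn_lt {n T : ℕ} (W : Finset (StorageNode n T)) {M : ℕ}
    (hM : M ≤ W.card) : {x ∈ W | (olderIn W x).card < M}.card = M := by
  rw [Finset.card_filter, sum_card_olderIn (fun i => if i < M then 1 else 0), ← Finset.card_filter]
  have : {i ∈ Finset.range W.card | i < M} = Finset.range M := by
    ext i; simp; omega
  rw [this, Finset.card_range]

/-! ### Min-cuts as costs of sets of storage nodes -/

namespace IFG

variable {n d : ℕ} (G : IFG n d)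

/-- The storage nodes that help the newcomer of repair `l`. -/
def helperNodes (l : Fin G.numRepairs) : Finset (StorageNode n G.numRepairs) :=
  (G.helpers l).image (activeNode G.failed l)

theorem card_helperNodes (l : Fin G.numRepairs) : (G.helperNodes l).card = d := by
  rw [helperNodes, Finset.card_image_of_injective _ (activeNode_injective _ _), G.card_helpers]

theorem birth_lt_of_mem_helperNodes {l : Fin G.numRepairs} {x : StorageNode n G.numRepairs}
    (hx : x ∈ G.helperNodes l) : birth x < birth (Sum.inr l : StorageNode n G.numRepairs) := by
  obtain ⟨i, -, rfl⟩ := Finset.mem_image.1 hx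
  exact birth_activeNode_lt _ _ _

theorem physicalNode_mem_helpers {l : Fin G.numRepairs} {x : StorageNode n G.numRepairs}
    (hx : x ∈ G.helperNodes l) : physicalNode G.failed x ∈ G.helpers l := by
  obtain ⟨i, hi, rfl⟩ := Finset.mem_image.1 hx
  simpa using hi

theorem inter_helperNodes_subset (W : Finset (StorageNode n G.numRepairs))
    (l : Fin G.numRepairs) : G.helperNodes l ∩ W ⊆ olderIn W (Sum.inr l) := fun _ hy =>
  Finset.mem_filter.2 ⟨(Finset.mem_inter.1 hy).2,
    G.birth_lt_of_mem_helperNodes (Finset.mem_inter.1 hy).1⟩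

theorem sub_card_olderIn_le (W : Finset (StorageNode n G.numRepairs)) (l : Fin G.numRepairs) :
    d - (olderIn W (Sum.inr l)).card ≤ (G.helperNodes l \ W).card := by
  have h1 := Finset.card_sdiff_add_card_inter (G.helperNodes l) W
  have h2 := Finset.card_le_card (G.inter_helperNodes_subset W l)
  rw [card_helperNodes] at h1
  omega

/-- The contribution of the storage node `x` to the cheapest cut for which `W` is the set of storage
nodes whose output vertices lie on the side of the data collector: either the edge from the input
to the output of `x` is cut, or all edges that lead into `x`. -/
noncomputable def nodeCost (α β : ℝ≥0∞) (W : Finset (StorageNode n G.numRepairs)) :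
    StorageNode n G.numRepairs → ℝ≥0∞
  | Sum.inl _ => α
  | Sum.inr l => min ((G.helperNodes l \ W).card * β) α

theorem exists_cost_le_cutValue {k : ℕ} (α β : ℝ≥0∞) (t : {S : Finset (Fin n) // S.card = k})
    (U : Finset (G.Vertex k)) (hs : Vertex.source ∈ U) (ht : Vertex.collector t ∉ U) :
    ∃ W : Finset (StorageNode n G.numRepairs),
      (∀ i ∈ t.1, activeNode G.failed G.numRepairs i ∈ W) ∧
      ∑ x ∈ W, G.nodeCost α β W x ≤ G.cutValue α β U := by
  by_cases hact : ∃ i ∈ t.1, Vertex.out (activeNode G.failed G.numRepairs i) ∈ U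
  · -- an edge of infinite capacity is cut
    obtain ⟨i, hi, hU⟩ := hact
    refine ⟨Finset.univ, fun _ _ => Finset.mem_univ _, ?_⟩
    have htop : G.cutValue α β U = ⊤ := by
      rw [cutValue, ENNReal.sum_eq_top]
      refine ⟨_, hU, ENNReal.sum_eq_top.2 ⟨_, Finset.mem_compl.2 ht, ?_⟩⟩
      exact if_pos ⟨i, hi, rfl⟩
    rw [htop]
    exact le_top
  push Not at hact
  refine ⟨({x | Vertex.out x ∉ U} : Finset _), fun i hi => by simpa using hact i hi, ?_⟩
  set W : Finset (StorageNode n G.numRepairs) := {x | Vertex.out x ∉ U} with hW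
  -- each `x ∈ W` is charged to the edges that enter one vertex of `x` on the far side
  let φ : StorageNode n G.numRepairs → G.Vertex k := fun x =>
    if Vertex.inp x ∈ U then Vertex.out x else Vertex.inp x
  have hφ : Function.Injective φ := by
    intro x y h
    simp only [φ] at h
    split_ifs at h
    all_goals simpa using h
  have hφU : W.map ⟨φ, hφ⟩ ⊆ Uᶜ := by
    intro v hv
    obtain ⟨x, hx, rfl⟩ := Finset.mem_map.1 hv
    simp only [hW, Finset.mem_filter, Finset.mem_univ, true_and] at hx
    simp only [Function.Embedding.coeFn_mk, Finset.mem_compl, φ]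
    split_ifs with h
    · exact hx
    · exact h
  rw [cutValue, Finset.sum_comm]
  refine le_trans ?_ (Finset.sum_le_sum_of_subset hφU)
  rw [Finset.sum_map]
  refine Finset.sum_le_sum fun x hx => ?_
  simp only [Function.Embedding.coeFn_mk, φ]
  split_ifs with h
  · have hcap : G.capacity (k := k) α β (Vertex.inp x) (Vertex.out x) = α := if_pos rfl
    calc G.nodeCost α β W x ≤ α := by
          rcases x with x | x
          · exact le_rfl
          · exact min_le_right _ _
      _ = G.capacity (k := k) α β (Vertex.inp x) (Vertex.out x) := hcap.symm
      _ ≤ _ := Finset.single_le_sum (f := fun u => G.capacity (k := k) α β u (Vertex.out x))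
          (fun _ _ => zero_le) h
  · rcases x with x | l
    · have hcap : G.capacity (k := k) α β Vertex.source (Vertex.inp (Sum.inl x)) = ⊤ := rfl
      have h2 := Finset.single_le_sum
        (f := fun u => G.capacity (k := k) α β u (Vertex.inp (Sum.inl x)))
        (fun _ _ => zero_le) hs
      rw [hcap] at h2
      exact le_top.trans h2
    · refine (min_le_left _ _).trans ?_
      have hsub : (G.helperNodes l \ W).map ⟨Vertex.out, fun _ _ => Vertex.out.inj⟩ ⊆ U := by
        intro v hv
        obtain ⟨y, hy, rfl⟩ := Finset.mem_map.1 hv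
        have hyU : Vertex.out y ∈ U := by simpa [hW] using (Finset.mem_sdiff.1 hy).2
        exact hyU
      refine le_trans ?_ (Finset.sum_le_sum_of_subset hsub)
      rw [Finset.sum_map, ← nsmul_eq_mul, ← Finset.sum_const]
      refine Finset.sum_le_sum fun y hy => ?_
      have : ∃ i ∈ G.helpers l, activeNode G.failed l i = y := by
        simpa [helperNodes] using (Finset.mem_sdiff.1 hy).1
      exact (if_pos this).ge

theorem minCut_le_cost {k : ℕ} (α β : ℝ≥0∞) (t : {S : Finset (Fin n) // S.card = k})
    (W : Finset (StorageNode n G.numRepairs))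
    (hW : ∀ i ∈ t.1, activeNode G.failed G.numRepairs i ∈ W) :
    G.minCut α β t ≤ ∑ x ∈ W, G.nodeCost α β W x := by
  classical
  -- the newcomers of `W` for which cutting the incoming edges is cheaper
  let W' : Finset (StorageNode n G.numRepairs) :=
    {x ∈ W | ∃ l, x = Sum.inr l ∧ (G.helperNodes l \ W).card * β ≤ α}
  let V : Finset (G.Vertex k) :=
    insert (Vertex.collector t) (W.image Vertex.out ∪ W'.image Vertex.inp)
  have hout : ∀ x, Vertex.out x ∈ V ↔ x ∈ W := by simp [V]
  have hinp : ∀ x, Vertex.inp x ∈ V ↔ x ∈ W' := by simp [V]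
  have hs : Vertex.source ∈ Vᶜ := by simp [V]
  have ht : Vertex.collector t ∉ Vᶜ := by simp [V]
  refine (iInf₂_le Vᶜ ⟨hs, ht⟩).trans ?_
  rw [cutValue, compl_compl, Finset.sum_comm]
  have hcol : ∑ u ∈ Vᶜ, G.capacity α β u (Vertex.collector t) = 0 := by
    refine Finset.sum_eq_zero fun u hu => ?_
    rcases u with _ | x | x | _
    · rfl
    · rfl
    · refine if_neg ?_
      rintro ⟨i, hi, rfl⟩
      exact Finset.mem_compl.1 hu ((hout _).2 (hW i hi))
    · rfl
  rw [Finset.sum_insert (by simp), hcol, zero_add,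
    Finset.sum_union (by
      rw [Finset.disjoint_left]
      intro u h1 h2
      obtain ⟨y, -, rfl⟩ := Finset.mem_image.1 h1
      simp at h2),
    Finset.sum_image (fun _ _ _ _ h => Vertex.out.inj h),
    Finset.sum_image (fun _ _ _ _ h => Vertex.inp.inj h),
    Finset.sum_filter, ← Finset.sum_add_distrib]
  refine Finset.sum_le_sum fun x hx => ?_
  have hα : ∑ u ∈ Vᶜ, G.capacity α β u (Vertex.out x) ≤ if x ∈ W' then 0 else α := by
    rw [← Finset.sum_subset (s₁ := if x ∈ W' then ∅ else {Vertex.inp x})]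
    · split_ifs with h
      · simp
      · simp [capacity]
    · split_ifs with h
      · simp
      · simpa [hinp] using h
    · intro u hu hu2
      rcases u with _ | y | y | _
      · rfl
      · refine if_neg ?_
        rintro rfl
        have h := Finset.mem_compl.1 hu
        rw [hinp] at h
        simp [h] at hu2
      · rfl
      · rfl
  have hxW' : x ∈ W' ↔ ∃ l, x = Sum.inr l ∧ (G.helperNodes l \ W).card * β ≤ α := by
    simp only [W', Finset.mem_filter, hx, true_and]
  refine (add_le_add_left hα _).trans ?_
  by_cases h : x ∈ W'
  · rw [if_pos h, zero_add, if_pos (hxW'.1 h)]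
    obtain ⟨l, rfl, hl⟩ := hxW'.1 h
    rw [nodeCost, min_eq_left hl, ← nsmul_eq_mul, ← Finset.sum_const,
      ← Finset.sum_image (s := G.helperNodes l \ W) (g := Vertex.out) (f := fun _ => β)
        (fun _ _ _ _ h => Vertex.out.inj h)]
    rw [← Finset.sum_subset (s₁ := (G.helperNodes l \ W).image Vertex.out)]
    · refine Finset.sum_le_sum fun u hu => ?_
      obtain ⟨y, -, rfl⟩ := Finset.mem_image.1 hu
      simp only [capacity]
      split_ifs <;> simp
    · intro u hu
      obtain ⟨y, hy, rfl⟩ := Finset.mem_image.1 hu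
      simpa [hout] using (Finset.mem_sdiff.1 hy).2
    · intro u hu hu2
      rcases u with _ | y | y | _
      · rfl
      · rfl
      · refine if_neg fun hy => hu2 ?_
        rw [Finset.mem_image]
        refine ⟨y, Finset.mem_sdiff.2 ⟨?_, ?_⟩, rfl⟩
        · simpa [helperNodes] using hy
        · simpa [hout] using hu
      · rfl
  · rw [if_neg h, if_neg (fun h' => h (hxW'.2 h')), add_zero]
    rcases x with x | l
    · exact le_rfl
    · rw [nodeCost, min_eq_right]
      by_contra hlt
      exact h (hxW'.2 ⟨l, rfl, (not_le.1 hlt).le⟩)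

theorem le_minCut_iff {k : ℕ} {α β c : ℝ≥0∞} {t : {S : Finset (Fin n) // S.card = k}} :
    c ≤ G.minCut α β t ↔ ∀ W : Finset (StorageNode n G.numRepairs),
      (∀ i ∈ t.1, activeNode G.failed G.numRepairs i ∈ W) →
        c ≤ ∑ x ∈ W, G.nodeCost α β W x := by
  refine ⟨fun h W hW => h.trans (G.minCut_le_cost α β t W hW), fun h => ?_⟩
  refine le_iInf₂ fun U hU => ?_
  obtain ⟨W, hW, hle⟩ := G.exists_cost_le_cutValue α β t U hU.1 hU.2
  exact (h W hW).trans hle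

theorem le_card_of_activeNode_mem {k : ℕ} {t : {S : Finset (Fin n) // S.card = k}}
    {W : Finset (StorageNode n G.numRepairs)}
    (hW : ∀ i ∈ t.1, activeNode G.failed G.numRepairs i ∈ W) : k ≤ W.card := by
  rw [← t.2, ← Finset.card_image_of_injective t.1 (activeNode_injective G.failed G.numRepairs)]
  refine Finset.card_le_card fun x hx => ?_
  obtain ⟨i, hi, rfl⟩ := Finset.mem_image.1 hx
  exact hW i hi

/-- The lower bound that holds for every information flow graph: the `i`-th oldest element of a set
`W` of storage nodes has at most `i` helpers in `W`. -/
theorem sum_le_minCut {k : ℕ} (α β : ℝ≥0∞) (t : {S : Finset (Fin n) // S.card = k}) :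
    ∑ i ∈ Finset.range k, min (((d - i : ℕ) : ℝ≥0∞) * β) α ≤ G.minCut α β t := by
  rw [le_minCut_iff]
  intro W hW
  calc ∑ i ∈ Finset.range k, min (((d - i : ℕ) : ℝ≥0∞) * β) α
      ≤ ∑ i ∈ Finset.range W.card, min (((d - i : ℕ) : ℝ≥0∞) * β) α :=
        Finset.sum_le_sum_of_subset
          (Finset.range_subset_range.2 (G.le_card_of_activeNode_mem hW))
    _ = ∑ x ∈ W, min (((d - (olderIn W x).card : ℕ) : ℝ≥0∞) * β) α :=
        (sum_card_olderIn (fun i => min (((d - i : ℕ) : ℝ≥0∞) * β) α) W).symm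
    _ ≤ _ := Finset.sum_le_sum fun x _ => ?_
  rcases x with x | l
  · exact min_le_right _ _
  · rw [nodeCost]
    gcongr
    exact G.sub_card_olderIn_le W l

end IFG

theorem sum_le_minMinCut {n d : ℕ} (C : Set (IFG n d)) (k : ℕ) (α β : ℝ≥0∞) :
    ∑ i ∈ Finset.range k, min (((d - i : ℕ) : ℝ≥0∞) * β) α ≤ minMinCut C k α β :=
  le_iInf₂ fun G _ => le_iInf fun t => G.sum_le_minCut α β t

theorem minMinCut_le {n d k : ℕ} {C : Set (IFG n d)} {G : IFG n d} (hG : G ∈ C) (α β : ℝ≥0∞)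
    (t : {S : Finset (Fin n) // S.card = k}) : minMinCut C k α β ≤ G.minCut α β t :=
  (iInf₂_le G hG).trans (iInf_le _ t)

theorem minMinCut_blindIFGs_le {n d k : ℕ} (A : HelperScheme n d) (α β : ℝ≥0∞) :
    minMinCut (blindIFGs n d) k α β ≤ minMinCut A.ifgs k α β :=
  biInf_mono (Set.subset_iUnion (fun A : HelperScheme n d => A.ifgs) A)

/-! ### Upper bounds from sets of newcomers -/

namespace IFG

variable {n : ℕ}

/-- The general lower bound is attained by a set of `k` newcomers that help one another as much as
possible. -/
theorem minCut_le_of_card_sdiff_le {k d : ℕ} (G : IFG n d)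
    (t : {S : Finset (Fin n) // S.card = k})
    (C : Finset (Fin G.numRepairs)) (hC : C.card = k)
    (ht : ∀ i ∈ t.1, activeNode G.failed G.numRepairs i ∈ C.map Function.Embedding.inr)
    (hhelp : ∀ l ∈ C, (G.helperNodes l \ C.map Function.Embedding.inr).card
      ≤ d - {i ∈ C | i < l}.card) (α β : ℝ≥0∞) :
    G.minCut α β t ≤ ∑ i ∈ Finset.range k, min (((d - i : ℕ) : ℝ≥0∞) * β) α := by
  refine (G.minCut_le_cost α β t _ ht).trans ?_
  set W : Finset (StorageNode n G.numRepairs) := C.map Function.Embedding.inr with hW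
  have hcard : W.card = k := by rw [hW, Finset.card_map, hC]
  rw [← hcard, ← sum_card_olderIn (fun i => min (((d - i : ℕ) : ℝ≥0∞) * β) α) W]
  refine Finset.sum_le_sum fun x hx => ?_
  obtain ⟨l, hl, rfl⟩ := Finset.mem_map.1 hx
  have holder : (olderIn W (Sum.inr l)).card = {i ∈ C | i < l}.card := by
    rw [olderIn, hW, Finset.filter_map, Finset.card_map]
    exact congrArg Finset.card (Finset.filter_congr fun i _ => by simp [birth])
  rw [Function.Embedding.inr_apply, holder, nodeCost]
  gcongr
  exact hhelp l hl

/-- A set of newcomers all but one of which have their only helper in the set costs as much as one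
repair. -/
theorem minCut_le_of_helperNodes_subset {k : ℕ} (G : IFG n 1)
    (t : {S : Finset (Fin n) // S.card = k})
    (C : Finset (Fin G.numRepairs)) (r : ℕ)
    (ht : ∀ i ∈ t.1, activeNode G.failed G.numRepairs i ∈ C.map Function.Embedding.inr)
    (hC : ∀ l ∈ C, (l : ℕ) ≠ r → G.helperNodes l ⊆ C.map Function.Embedding.inr) (α β : ℝ≥0∞) :
    G.minCut α β t ≤ min β α := by
  refine (G.minCut_le_cost α β t _ ht).trans ?_
  set W : Finset (StorageNode n G.numRepairs) := C.map Function.Embedding.inr with hW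
  nth_rw 1 [hW]
  rw [Finset.sum_map]
  calc _ ≤ ∑ l ∈ C, if (l : ℕ) = r then min β α else 0 := Finset.sum_le_sum fun l hl => ?_
    _ ≤ min β α := by
        rw [← Finset.sum_filter, Finset.sum_const, nsmul_eq_mul]
        refine mul_le_of_le_one_left zero_le ?_
        have : (C.filter fun l : Fin G.numRepairs => (l : ℕ) = r).card ≤ 1 :=
          Finset.card_le_one.2 fun a ha b hb =>
            Fin.ext ((Finset.mem_filter.1 ha).2.trans (Finset.mem_filter.1 hb).2.symm)
        exact_mod_cast this
  rw [Function.Embedding.inr_apply, nodeCost]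
  split_ifs with hlr
  · have hle : (G.helperNodes l \ W).card ≤ 1 :=
      (Finset.card_le_card Finset.sdiff_subset).trans (G.card_helperNodes l).le
    gcongr
    refine mul_le_of_le_one_left zero_le ?_
    exact_mod_cast hle
  · rw [Finset.sdiff_eq_empty_iff_subset.2 (hC l hl hlr)]
    simp

end IFG

/-! ### Failing every node once -/

/-- The information flow graph of the scheme `A` in which the nodes `F 0, …, F (T - 1)` fail. -/
def HelperScheme.graph {n d : ℕ} (A : HelperScheme n d) (T : ℕ) (F : ℕ → Fin n) : IFG n d where
  numRepairs := T
  failed l := F l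
  helpers l := A.helpers l (fun j => F j)
  card_helpers _ := A.card_helpers _ _
  failed_notMem l := A.failed_notMem l (fun j => F j)

theorem HelperScheme.graph_mem_ifgs {n d : ℕ} (A : HelperScheme n d) (T : ℕ) (F : ℕ → Fin n) :
    A.graph T F ∈ A.ifgs := fun _ => rfl

/-- A failure sequence that starts with `0, …, n - 1`. -/
def sweep {n : ℕ} (hn : 0 < n) (j : ℕ) : Fin n := ⟨j % n, Nat.mod_lt j hn⟩

theorem sweep_val {n : ℕ} (hn : 0 < n) (i : Fin n) : sweep hn i = i :=
  Fin.ext (Nat.mod_eq_of_lt i.isLt)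

theorem activeNode_sweep {n : ℕ} (hn : 0 < n) {l : ℕ} (hl : l ≤ n) (i : Fin n) :
    activeNode (fun j : Fin n => sweep hn j) l i = if (i : ℕ) < l then Sum.inr i else Sum.inl i := by
  induction l with
  | zero => simp [activeNode]
  | succ l ih =>
    have hl' : l < n := hl
    rw [activeNode, dif_pos hl', ih hl'.le, sweep_val hn ⟨l, hl'⟩]
    by_cases h : (i : ℕ) = l
    · subst h; simp
    · rw [if_neg (fun h' => h (by rw [← h'])) ]
      congr 1
      simp only [eq_iff_iff]; omega

/-- If every node fails once, in order, then the newcomers of a set `C` of `k` nodes are a cheap cut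
as soon as they help one another as much as possible. -/
theorem minMinCut_le_of_sweep {n d k : ℕ} (hn : 0 < n) (A : HelperScheme n d) (C : Finset (Fin n))
    (hC : C.card = k)
    (hhelp : ∀ l ∈ C, (A.helpers l (fun j => sweep hn j) \ {i ∈ C | i < l}).card
      ≤ d - {i ∈ C | i < l}.card) (α β : ℝ≥0∞) :
    minMinCut A.ifgs k α β ≤ ∑ i ∈ Finset.range k, min (((d - i : ℕ) : ℝ≥0∞) * β) α := by
  refine (minMinCut_le (A.graph_mem_ifgs n (sweep hn)) α β ⟨C, hC⟩).trans
    (IFG.minCut_le_of_card_sdiff_le _ ⟨C, hC⟩ C hC (fun i hi => ?_) (fun l hl => ?_) α β)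
  · have h : activeNode (fun j : Fin n => sweep hn j) n i = Sum.inr i :=
      (activeNode_sweep hn le_rfl i).trans (if_pos i.isLt)
    exact Finset.mem_map.2 ⟨i, hi, h.symm⟩
  · refine (Finset.card_le_card (fun y hy => ?_)).trans
      ((Finset.card_image_le (f := activeNode (fun j : Fin n => sweep hn j) l)).trans (hhelp l hl))
    obtain ⟨h1, h2⟩ := Finset.mem_sdiff.1 hy
    obtain ⟨i, hi, rfl⟩ := Finset.mem_image.1 h1
    refine Finset.mem_image_of_mem _ (Finset.mem_sdiff.2 ⟨hi, fun h => h2 ?_⟩)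
    obtain ⟨hiC, hil⟩ := Finset.mem_filter.1 h
    have h : activeNode (fun j : Fin n => sweep hn j) l i = Sum.inr i :=
      (activeNode_sweep hn l.isLt.le i).trans (if_pos hil)
    exact Finset.mem_map.2 ⟨i, hiC, h.symm⟩

/-- The scheme in which the newcomer is helped by the first `d` of the other nodes. It attains the
smallest min-cut over all schemes. -/
def firstNodesScheme {n d : ℕ} (hdn : d < n) : StationaryScheme n d where
  helperSet i := if (i : ℕ) < d then (Finset.Iic ⟨d, hdn⟩).erase i else Finset.Iio ⟨d, hdn⟩
  card_helperSet i := by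
    split_ifs with h
    · rw [Finset.card_erase_of_mem (by simpa [Fin.le_def] using h.le), Fin.card_Iic]
      simp
    · simp
  self_notMem i := by
    split_ifs with h
    · simp
    · simpa [Fin.lt_def] using h

theorem minMinCut_blindIFGs {n k d : ℕ} (hkn : k ≤ n) (hdn : d < n) (α β : ℝ≥0∞) :
    minMinCut (blindIFGs n d) k α β
      = ∑ i ∈ Finset.range k, min (((d - i : ℕ) : ℝ≥0∞) * β) α := by
  have hn : 0 < n := by omega
  refine le_antisymm ?_ (sum_le_minMinCut _ k α β)
  refine (minMinCut_blindIFGs_le (firstNodesScheme hdn).toHelperScheme α β).trans ?_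
  have hC : ({i | (i : ℕ) < k} : Finset (Fin n)).card = k := by
    rw [Fin.card_filter_val_lt, min_eq_right hkn]
  refine minMinCut_le_of_sweep hn _ {i | (i : ℕ) < k} hC (fun l hl => ?_) α β
  have hlk : (l : ℕ) < k := by simpa using hl
  have hlt : ({i ∈ ({i | (i : ℕ) < k} : Finset (Fin n)) | i < l}) = Finset.Iio l := by
    ext i
    simp only [Finset.mem_filter, Finset.mem_univ, true_and, Finset.mem_Iio, Fin.lt_def]
    omega
  have hset : (firstNodesScheme hdn).toHelperScheme.helpers l (fun j => sweep hn j)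
      = (firstNodesScheme hdn).helperSet l :=
    congrArg (firstNodesScheme hdn).helperSet (sweep_val hn l)
  have hdef : (firstNodesScheme hdn).helperSet l = if (l : ℕ) < d then
      (Finset.Iic ⟨d, hdn⟩).erase l else Finset.Iio ⟨d, hdn⟩ := rfl
  rw [hlt, hset, Fin.card_Iio, hdef]
  by_cases h : (l : ℕ) < d
  · rw [if_pos h]
    have : (Finset.Iic ⟨d, hdn⟩).erase l \ Finset.Iio l ⊆ Finset.Ioc l ⟨d, hdn⟩ := by
      intro i
      simp only [Finset.mem_sdiff, Finset.mem_erase, Finset.mem_Iic, Finset.mem_Iio,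
        Finset.mem_Ioc, Fin.le_def, Fin.lt_def, ne_eq, Fin.ext_iff]
      omega
    refine (Finset.card_le_card this).trans ?_
    simp
  · rw [if_neg h, Finset.sdiff_eq_empty_iff_subset.2]
    · simp
    · intro i
      simp only [Finset.mem_Iio, Fin.lt_def]
      omega

/-! ### Chains of newcomers that help one another -/

/-- If every `j` has at most `m - 1` smaller elements that are not in `H j`, then a set of more than
`r * m` elements contains `r + 1` elements each of which has the smaller ones in its set `H`. They
are found by repeatedly taking the largest element, and discarding those not in its set. -/
theorem exists_chain {n m : ℕ} (H : Fin n → Finset (Fin n))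
    (hH : ∀ j, ({i | i < j ∧ i ∉ H j} : Finset (Fin n)).card < m) (r : ℕ) (S : Finset (Fin n))
    (hS : r * m < S.card) :
    ∃ C ⊆ S, C.card = r + 1 ∧ ∀ j ∈ C, ∀ i ∈ C, i < j → i ∈ H j := by
  induction r generalizing S with
  | zero =>
    obtain ⟨j, hj⟩ := Finset.card_pos.1 (by omega : 0 < S.card)
    refine ⟨{j}, by simpa using hj, by simp, ?_⟩
    intro a ha b hb hlt
    rw [Finset.mem_singleton] at ha hb
    exact absurd hlt (by rw [ha, hb]; exact lt_irrefl _)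
  | succ r ih =>
    have hne : S.Nonempty := Finset.card_pos.1 (by omega)
    set j := S.max' hne with hj
    have hjS : j ∈ S := S.max'_mem hne
    have hmiss := hH j
    have hcover : S ⊆ {i ∈ S | i < j ∧ i ∈ H j} ∪
        insert j ({i | i < j ∧ i ∉ H j} : Finset (Fin n)) := by
      intro i hi
      have hle : i ≤ j := S.le_max' i hi
      rcases eq_or_lt_of_le hle with h | h
      · simp [h]
      · by_cases h2 : i ∈ H j <;> simp [hi, h, h2]
    have hcard := (Finset.card_le_card hcover).trans (Finset.card_union_le _ _)
    have hins := Finset.card_insert_le j ({i | i < j ∧ i ∉ H j} : Finset (Fin n))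
    obtain ⟨C, hCS, hC, hchain⟩ := ih {i ∈ S | i < j ∧ i ∈ H j} (by rw [Nat.succ_mul] at hS; omega)
    have hCj : ∀ i ∈ C, i < j ∧ i ∈ H j := fun i hi => (Finset.mem_filter.1 (hCS hi)).2
    refine ⟨insert j C, ?_, ?_, ?_⟩
    · exact Finset.insert_subset hjS (hCS.trans (Finset.filter_subset _ _))
    · rw [Finset.card_insert_of_notMem fun h => lt_irrefl _ (hCj j h).1, hC]
    · intro a ha b hb hlt
      rcases Finset.mem_insert.1 ha with rfl | ha
      · rcases Finset.mem_insert.1 hb with rfl | hb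
        · exact absurd hlt (lt_irrefl _)
        · exact (hCj b hb).2
      · rcases Finset.mem_insert.1 hb with rfl | hb
        · exact absurd hlt (hCj a ha).1.asymm
        · exact hchain a ha b hb hlt

/-- The condition says that `k ≤ ⌈n / (n - d)⌉`. Once every node has failed, each newcomer lacks the
help of at most `n - d - 1` of the older ones, so that `k` newcomers form a chain. -/
theorem minMinCut_le_of_mul_lt {n k d : ℕ} (hk : 1 ≤ k) (hdn : d < n)
    (h : (k - 1) * (n - d) < n) (A : HelperScheme n d) (α β : ℝ≥0∞) :
    minMinCut A.ifgs k α β ≤ ∑ i ∈ Finset.range k, min (((d - i : ℕ) : ℝ≥0∞) * β) α := by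
  have hn : 0 < n := by omega
  let H : Fin n → Finset (Fin n) := fun l => A.helpers l (fun j => sweep hn j)
  have hself : ∀ l, l ∉ H l := fun l hl =>
    A.failed_notMem l (fun j => sweep hn j) (by
      have : sweep hn (Fin.last (l : ℕ)) = l := sweep_val hn l
      rwa [this])
  obtain ⟨C, -, hC, hchain⟩ := exists_chain (m := n - d) H (fun j => by
    have hsub : ({i | i < j ∧ i ∉ H j} : Finset (Fin n)) ⊆ (H j)ᶜ.erase j := by
      intro i
      simp +contextual [ne_of_lt]
    have h1 := Finset.card_le_card hsub
    rw [Finset.card_erase_of_mem (by simpa using hself j), Finset.card_compl, A.card_helpers,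
      Fintype.card_fin] at h1
    omega) (k - 1) Finset.univ (by simpa using h)
  refine minMinCut_le_of_sweep hn A C (by omega) (fun l hl => ?_) α β
  rw [Finset.card_sdiff_of_subset, A.card_helpers]
  intro i hi
  exact hchain l hl i (Finset.mem_filter.1 hi).1 (Finset.mem_filter.1 hi).2

/-! ### Single helpers: trees of newcomers -/

/-- For a single helper per repair (`h l` for repair `l`), each newcomer whose helper is an initial
node is the root of a tree of newcomers. `treeRoot F h l i` is the root of the tree of the storage
node that is active at `i` after `l` repairs, and `none` if that is an initial node. -/
def treeRoot {n : ℕ} (F h : ℕ → Fin n) : ℕ → Fin n → Option ℕ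
  | 0 => fun _ => none
  | l + 1 => Function.update (treeRoot F h l) (F l) (some ((treeRoot F h l (h l)).getD l))

theorem treeRoot_congr {n : ℕ} {F F' h h' : ℕ → Fin n} {T : ℕ} (hF : ∀ l < T, F l = F' l)
    (hh : ∀ l < T, h l = h' l) : treeRoot F h T = treeRoot F' h' T := by
  induction T with
  | zero => rfl
  | succ T ih =>
    rw [treeRoot, treeRoot, ih (fun l hl => hF l (by omega)) (fun l hl => hh l (by omega)),
      hF T (by omega), hh T (by omega)]

theorem treeRoot_of_activeNode_eq_inl {n T : ℕ} {F : ℕ → Fin n} (h : ℕ → Fin n) {l : ℕ}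
    (hl : l ≤ T) {i j : Fin n} (hi : activeNode (fun j : Fin T => F j) l i = Sum.inl j) :
    treeRoot F h l i = none := by
  induction l with
  | zero => rfl
  | succ l ih =>
    have hlT : l < T := hl
    rw [activeNode, dif_pos hlT] at hi
    split_ifs at hi with h1
    rw [treeRoot, Function.update_of_ne (Ne.symm h1), ih hlT.le hi]

theorem treeRoot_of_activeNode_eq_inr {n T : ℕ} {F : ℕ → Fin n} (h : ℕ → Fin n) {l : ℕ}
    (hl : l ≤ T) {i : Fin n} {j : Fin T}
    (hi : activeNode (fun j : Fin T => F j) l i = Sum.inr j) :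
    treeRoot F h l i = treeRoot F h (j + 1) (F j) := by
  induction l with
  | zero => simp [activeNode] at hi
  | succ l ih =>
    have hlT : l < T := hl
    rw [activeNode, dif_pos hlT] at hi
    split_ifs at hi with h1
    · obtain rfl := Sum.inr.inj hi
      rw [← h1]
    · rw [treeRoot, Function.update_of_ne (Ne.symm h1), ih hlT.le hi]

/-- A tree of newcomers is a cut whose cost is that of repairing its root. -/
theorem minMinCut_le_of_treeRoot {n k : ℕ} (A : HelperScheme n 1) {T : ℕ} {F h : ℕ → Fin n}
    (hh : ∀ l < T, A.helpers l (fun j => F j) = {h l}) {r : ℕ} {t : Finset (Fin n)}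
    (ht : t.card = k) (htr : ∀ i ∈ t, treeRoot F h T i = some r) (α β : ℝ≥0∞) :
    minMinCut A.ifgs k α β ≤ min β α := by
  let C : Finset (Fin T) := {l | treeRoot F h (l + 1) (F l) = some r}
  have hmem : ∀ l i, l ≤ T → treeRoot F h l i = some r →
      activeNode (fun j : Fin T => F j) l i ∈ C.map Function.Embedding.inr := by
    intro l i hl hi
    rcases hx : activeNode (fun j : Fin T => F j) l i with j | j
    · rw [treeRoot_of_activeNode_eq_inl h hl hx] at hi
      simp at hi
    · rw [treeRoot_of_activeNode_eq_inr h hl hx] at hi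
      exact Finset.mem_map_of_mem _ (Finset.mem_filter.2 ⟨Finset.mem_univ _, hi⟩)
  refine (minMinCut_le (A.graph_mem_ifgs T F) α β ⟨t, ht⟩).trans
    (IFG.minCut_le_of_helperNodes_subset _ ⟨t, ht⟩ C r (fun i hi => hmem T i le_rfl (htr i hi))
      (fun l hl hlr => ?_) α β)
  -- a newcomer that is not the root has its helper in the tree
  have hroot : treeRoot F h l (h l) = some r := by
    have hl' := (Finset.mem_filter.1 hl).2
    rw [treeRoot, Function.update_self, Option.some.injEq] at hl'
    rcases hx : treeRoot F h l (h l) with _ | s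
    · rw [hx] at hl'
      exact absurd hl' hlr
    · rw [hx] at hl'
      exact congrArg some hl'
  intro y hy
  obtain ⟨i, hi, rfl⟩ := Finset.mem_image.1 hy
  have hi' : i ∈ ({h l} : Finset (Fin n)) := hh l l.isLt ▸ hi
  rw [Finset.mem_singleton.1 hi']
  exact hmem l (h l) l.isLt.le hroot

theorem isSome_treeRoot_succ {n : ℕ} {F h : ℕ → Fin n} {l : ℕ} {i : Fin n}
    (hi : i = F l ∨ (treeRoot F h l i).isSome) : (treeRoot F h (l + 1) i).isSome := by
  rw [treeRoot, Function.update_apply]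
  split_ifs with h1
  · rfl
  · exact hi.resolve_left h1

/-- A function on an odd number of points with fibres of at most two points has a fibre with exactly
one point. -/
theorem exists_unique_fiber {n : ℕ} (hn : Odd n) {γ : Type*} (f : Fin n → γ)
    (hf : ∀ t : Finset (Fin n), t.card = 3 → ∀ r, ¬ ∀ i ∈ t, f i = r) :
    ∃ p, ∀ i, f i = f p → i = p := by
  classical
  by_contra! hcon
  have hfib : ∀ r ∈ Finset.univ.image f, ({i | f i = r} : Finset (Fin n)).card = 2 := by
    intro r hr
    obtain ⟨p, -, rfl⟩ := Finset.mem_image.1 hr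
    obtain ⟨q, hq, hqp⟩ := hcon p
    refine le_antisymm ?_ ?_
    · by_contra! h3
      obtain ⟨t, ht, ht3⟩ := Finset.exists_subset_card_eq (Nat.succ_le_of_lt h3)
      exact hf t ht3 _ fun i hi => by simpa using ht hi
    · exact Finset.one_lt_card.2 ⟨p, by simp, q, by simpa using hq, hqp.symm⟩
  have hsum := Finset.card_eq_sum_card_image f (Finset.univ : Finset (Fin n))
  rw [Finset.sum_congr rfl hfib, Finset.sum_const, Finset.card_univ, Fintype.card_fin] at hsum
  have heven : Even n := ⟨_, by rw [smul_eq_mul, mul_two] at hsum; exact hsum⟩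
  exact (Nat.not_even_iff_odd.2 hn) heven

/-- For an odd number of nodes and one helper per repair, failures can be chosen so that three active
nodes are in the same tree. As long as this is not the case, some active node is alone in its tree,
by parity. If it fails, the newcomer joins another tree, and the number of trees decreases. -/
theorem exists_three_of_treeRoot {n : ℕ} (hn : Odd n) (A : HelperScheme n 1) (F : ℕ → Fin n)
    {T : ℕ} {h : ℕ → Fin n} (hh : ∀ l < T, A.helpers l (fun j => F j) = {h l})
    (hsome : ∀ i, (treeRoot F h T i).isSome) :
    ∃ (T : ℕ) (F h : ℕ → Fin n), (∀ l < T, A.helpers l (fun j => F j) = {h l}) ∧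
      ∃ (t : Finset (Fin n)) (r : ℕ), t.card = 3 ∧ ∀ i ∈ t, treeRoot F h T i = some r := by
  induction hN : (Finset.univ.image (treeRoot F h T)).card using Nat.strong_induction_on
    generalizing F T h with
  | _ N ih =>
  subst hN
  by_cases hthree : ∃ (t : Finset (Fin n)) (r : ℕ), t.card = 3 ∧ ∀ i ∈ t, treeRoot F h T i = some r
  · exact ⟨T, F, h, hh, hthree⟩
  obtain ⟨p, hp⟩ := exists_unique_fiber hn (treeRoot F h T) (by
    intro t ht r hr
    obtain ⟨i, hi⟩ := Finset.card_pos.1 (by omega : 0 < t.card)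
    obtain ⟨s, hs⟩ := Option.isSome_iff_exists.1 (hsome i)
    exact hthree ⟨t, s, ht, fun j hj => by rw [hr j hj, ← hr i hi, hs]⟩)
  let F' := Function.update F T p
  have hF' : ∀ l < T, F' l = F l := fun l hl => Function.update_of_ne hl.ne _ _
  have hF'T : F' T = p := Function.update_self _ _ _
  obtain ⟨q, hq⟩ := Finset.card_eq_one.1 (A.card_helpers T (fun j => F' j))
  let h' := Function.update h T q
  have hh'l : ∀ l < T, h' l = h l := fun l hl => Function.update_of_ne hl.ne _ _
  have hh'T : h' T = q := Function.update_self _ _ _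
  have hroot : treeRoot F' h' T = treeRoot F h T := treeRoot_congr hF' hh'l
  have hqp : q ≠ p := by
    rintro rfl
    have := A.failed_notMem T (fun j => F' j)
    rw [hq] at this
    simp [hF'T] at this
  have hh' : ∀ l < T + 1, A.helpers l (fun j => F' j) = {h' l} := by
    intro l hl
    rcases Nat.lt_succ_iff_lt_or_eq.1 hl with hl | rfl
    · rw [hh'l l hl, ← hh l hl]
      congr 1
      funext j
      exact hF' j (by omega)
    · rw [hh'T, hq]
  have hnew : treeRoot F' h' (T + 1) = Function.update (treeRoot F h T) p (treeRoot F h T q) := by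
    obtain ⟨s, hs⟩ := Option.isSome_iff_exists.1 (hsome q)
    rw [treeRoot, hroot, hF'T, hh'T, hs, Option.getD_some]
  refine ih _ ?_ F' hh' (fun i => ?_) rfl
  · refine Finset.card_lt_card (Finset.ssubset_iff_of_subset ?_ |>.2 ?_)
    · intro x hx
      obtain ⟨i, -, rfl⟩ := Finset.mem_image.1 hx
      rw [hnew, Function.update_apply]
      split_ifs <;> exact Finset.mem_image_of_mem _ (Finset.mem_univ _)
    · refine ⟨treeRoot F h T p, Finset.mem_image_of_mem _ (Finset.mem_univ _), fun hx => ?_⟩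
      obtain ⟨i, -, hi⟩ := Finset.mem_image.1 hx
      rw [hnew, Function.update_apply] at hi
      split_ifs at hi with h1
      · exact hqp (hp q hi)
      · exact h1 (hp i hi)
  · rw [hnew, Function.update_apply]
    split_ifs <;> exact hsome _

theorem minMinCut_three_le {n : ℕ} (hn : Odd n) (A : HelperScheme n 1) (α β : ℝ≥0∞) :
    minMinCut A.ifgs 3 α β ≤ min β α := by
  have hn0 : 0 < n := hn.pos
  choose h hh using fun l => Finset.card_eq_one.1 (A.card_helpers l (fun j => sweep hn0 j))
  have hsome : ∀ T (i : Fin n), (i : ℕ) < T → (treeRoot (sweep hn0) h T i).isSome := by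
    intro T
    induction T with
    | zero => intro i hi; omega
    | succ T ih =>
      intro i hi
      refine isSome_treeRoot_succ ?_
      rcases Nat.lt_succ_iff_lt_or_eq.1 hi with hi | rfl
      · exact Or.inr (ih i hi)
      · exact Or.inl (sweep_val hn0 i).symm
  obtain ⟨T, F, h, hh, t, r, ht, htr⟩ := exists_three_of_treeRoot hn A (sweep hn0) (T := n)
    (fun l _ => hh l) (fun i => hsome n i i.isLt)
  exact minMinCut_le_of_treeRoot A hh ht htr α β

/-! ### Sets of storage nodes of least cost -/

namespace IFG

variable {n d : ℕ} (G : IFG n d)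

/-- The cost of a storage node for `β = 1` and a storage size `a ≥ d`, for which cutting the edges
into a newcomer is never more expensive than cutting its storage edge. -/
def natCost (a : ℕ) (W : Finset (StorageNode n G.numRepairs)) : StorageNode n G.numRepairs → ℕ
  | Sum.inl _ => a
  | Sum.inr l => (G.helperNodes l \ W).card

theorem nodeCost_eq_natCost {a : ℕ} (ha : d ≤ a) (W : Finset (StorageNode n G.numRepairs))
    (x : StorageNode n G.numRepairs) : G.nodeCost a 1 W x = G.natCost a W x := by
  rcases x with x | l
  · rfl
  · have h : (G.helperNodes l \ W).card ≤ a :=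
      ((Finset.card_le_card Finset.sdiff_subset).trans (G.card_helperNodes l).le).trans ha
    rw [nodeCost, natCost, mul_one, min_eq_left]
    exact_mod_cast h

/-- A set of at least `k` storage nodes whose cost does not exceed the general lower bound consists
of newcomers, and its `i`-th oldest element has as many helpers in the set as possible (if `i < k`),
or all of them. -/
theorem exists_eq_inr_of_sum_natCost_le {k a : ℕ} {W : Finset (StorageNode n G.numRepairs)}
    (hk : k ≤ W.card) (ha : ∑ i ∈ Finset.range k, (d - i) < a)
    (hle : ∑ x ∈ W, G.natCost a W x ≤ ∑ i ∈ Finset.range k, (d - i))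
    {x : StorageNode n G.numRepairs} (hx : x ∈ W) :
    ∃ l, x = Sum.inr l ∧ (G.helperNodes l \ W).card =
      if (olderIn W x).card < k then d - (olderIn W x).card else 0 := by
  have hnew : ∀ y ∈ W, ∃ l, y = Sum.inr l := by
    rintro (y | l) hy
    · have := Finset.single_le_sum (f := G.natCost a W) (fun _ _ => Nat.zero_le _) hy
      have h2 : G.natCost a W (Sum.inl y) = a := rfl
      omega
    · exact ⟨l, rfl⟩
  have hsum : ∑ y ∈ W, (if (olderIn W y).card < k then d - (olderIn W y).card else 0)
      = ∑ i ∈ Finset.range k, (d - i) := by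
    rw [sum_card_olderIn (fun i => if i < k then d - i else 0), ← Finset.sum_filter]
    congr 1
    ext i; simp; omega
  have hge : ∀ y ∈ W, (if (olderIn W y).card < k then d - (olderIn W y).card else 0)
      ≤ G.natCost a W y := by
    intro y hy
    obtain ⟨l, rfl⟩ := hnew y hy
    split_ifs
    · exact G.sub_card_olderIn_le W l
    · exact Nat.zero_le _
  have heq := (Finset.sum_eq_sum_iff_of_le hge).1
    (le_antisymm (Finset.sum_le_sum hge) (hsum ▸ hle)) x hx
  obtain ⟨l, rfl⟩ := hnew x hx
  exact ⟨l, rfl, heq.symm⟩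

end IFG

/-- A strict lower bound for the min-cuts follows, for suitable `α` and `β`, if no set of at least
`k` storage nodes attains the general lower bound with `β = 1`. -/
theorem exists_lt_minMinCut {n d k : ℕ} {C : Set (IFG n d)}
    (hC : ∀ G ∈ C, ∀ t : {S : Finset (Fin n) // S.card = k},
      ∀ W : Finset (StorageNode n G.numRepairs),
      (∀ i ∈ t.1, activeNode G.failed G.numRepairs i ∈ W) →
      (∀ x ∈ W, ∃ l, x = Sum.inr l ∧ (G.helperNodes l \ W).card =
        if (olderIn W x).card < k then d - (olderIn W x).card else 0) → False) :
    ∃ α β : ℝ≥0, 0 < α ∧ 0 < β ∧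
      ∑ i ∈ Finset.range k, min (((d - i : ℕ) : ℝ≥0∞) * (β : ℝ≥0∞)) (α : ℝ≥0∞)
        < minMinCut C k α β := by
  -- the storage size is larger than the general lower bound, so that initial nodes are not used
  set s := ∑ i ∈ Finset.range k, (d - i) with hs
  refine ⟨((d + s + 1 : ℕ) : ℝ≥0), 1, by positivity, one_pos, ?_⟩
  have hsum : ∑ i ∈ Finset.range k, min (((d - i : ℕ) : ℝ≥0∞) * ((1 : ℝ≥0) : ℝ≥0∞))
      (((d + s + 1 : ℕ) : ℝ≥0) : ℝ≥0∞) = (s : ℝ≥0∞) := by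
    rw [hs, Nat.cast_sum]
    refine Finset.sum_congr rfl fun i _ => ?_
    rw [ENNReal.coe_one, mul_one, ENNReal.coe_natCast, min_eq_left]
    exact_mod_cast (by omega : d - i ≤ d + s + 1)
  rw [hsum]
  refine lt_of_lt_of_le (b := ((s + 1 : ℕ) : ℝ≥0∞)) (by exact_mod_cast Nat.lt_succ_self s) ?_
  refine le_iInf₂ fun G hG => le_iInf fun t => G.le_minCut_iff.2 fun W hW => ?_
  rw [ENNReal.coe_natCast, ENNReal.coe_one,
    Finset.sum_congr rfl fun x _ => G.nodeCost_eq_natCost (by omega : d ≤ d + s + 1) W x]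
  by_contra hlt
  rw [not_le] at hlt
  have hlt' : ∑ x ∈ W, G.natCost (d + s + 1) W x < s + 1 := by exact_mod_cast hlt
  exact hC G hG t W hW fun x hx => G.exists_eq_inr_of_sum_natCost_le
    (G.le_card_of_activeNode_mem hW) (by omega) (Nat.lt_succ_iff.1 hlt') hx

/-- In a set of storage nodes that attains the general lower bound, the oldest `min k (d + 1)`
elements help one another. -/
theorem IFG.mem_helperNodes_of_tight {n d : ℕ} (G : IFG n d) {k : ℕ}
    {W : Finset (StorageNode n G.numRepairs)} {l : Fin G.numRepairs}
    (hW : (G.helperNodes l \ W).card = if (olderIn W (Sum.inr l)).card < k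
      then d - (olderIn W (Sum.inr l)).card else 0)
    (hl : (olderIn W (Sum.inr l)).card < min k (d + 1)) {y : StorageNode n G.numRepairs}
    (hy : y ∈ W) (hyl : birth y < birth (Sum.inr l : StorageNode n G.numRepairs)) :
    y ∈ G.helperNodes l := by
  rw [lt_min_iff] at hl
  rw [if_pos hl.1] at hW
  have h1 := Finset.card_sdiff_add_card_inter (G.helperNodes l) W
  rw [G.card_helperNodes] at h1
  have heq := Finset.eq_of_subset_of_card_le (G.inter_helperNodes_subset W l) (by omega)
  have : y ∈ olderIn W (Sum.inr l) := Finset.mem_filter.2 ⟨hy, hyl⟩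
  rw [← heq] at this
  exact (Finset.mem_inter.1 this).1

/-! ### The family-plus scheme -/

theorem groupOf_add {n d g a : ℕ} (hd : 1 ≤ d) (hg : g ≤ numGroups n d - 1)
    (ha : a < groupSize n d g) : groupOf n d (2 * d * g + a) = g := by
  have hdiv : (2 * d * g + a) / (2 * d) = g + a / (2 * d) := by
    rw [add_comm, Nat.add_mul_div_left _ _ (by omega), add_comm]
  rw [groupOf, hdiv]
  unfold groupSize at ha
  split_ifs at ha with h
  · rw [Nat.div_eq_of_lt ha]
    omega
  · generalize a / (2 * d) = b
    omega

theorem sub_lt_groupSize {n d i : ℕ} (hd : 1 ≤ d) (hi : i < n) :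
    i - 2 * d * groupOf n d i < groupSize n d (groupOf n d i) := by
  have hs := group_start_le n d i
  have hm := Nat.lt_mul_div_succ i (by omega : 0 < 2 * d)
  unfold groupSize
  split_ifs with h
  · have : groupOf n d i = i / (2 * d) := by
      unfold groupOf at h ⊢
      omega
    rw [this]
    rw [Nat.mul_add] at hm
    omega
  · have : groupOf n d i = numGroups n d - 1 := by
      have : groupOf n d i ≤ numGroups n d - 1 := min_le_right _ _
      omega
    rw [← this]
    omega

theorem groupOf_eq_of_mem {n d i j : ℕ} (hd : 1 ≤ d) (hdn : d < n)
    (hj : j ∈ familyPlusHelpers n d i) : groupOf n d j = groupOf n d i := by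
  obtain ⟨a, ha, rfl⟩ := Finset.mem_map.1 hj
  exact groupOf_add hd (min_le_right _ _) (familyHelpers_lt (lt_groupSize hd hdn _) ha)

theorem div_ne_of_mem_familyHelpers {N d i j : ℕ} (hd : d < N) (hj : j ∈ familyHelpers N d i) :
    j / (N - d) ≠ i / (N - d) := by
  unfold familyHelpers at hj
  split_ifs at hj with h
  · exact (Finset.mem_filter.1 hj).2
  · -- the first `d` nodes are in complete families
    have hm : 0 < N - d := Nat.sub_pos_of_lt hd
    have h1 := Nat.div_add_mod N (N - d)
    have h2 := Nat.mod_lt N hm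
    rw [mul_comm] at h1
    rw [Finset.mem_range] at hj
    have hj' : j / (N - d) < N / (N - d) := (Nat.div_lt_iff_lt_mul hm).2 (by omega)
    have hi' : N / (N - d) ≤ i / (N - d) := (Nat.le_div_iff_mul_le hm).2 (by omega)
    omega

/-- The number of the family of node `i` within its group. -/
def familyOf (n d i : ℕ) : ℕ :=
  (i - 2 * d * groupOf n d i) / (groupSize n d (groupOf n d i) - d)

theorem familyOf_ne_of_mem {n d i j : ℕ} (hd : 1 ≤ d) (hdn : d < n)
    (hj : j ∈ familyPlusHelpers n d i) : familyOf n d j ≠ familyOf n d i := by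
  have hg := groupOf_eq_of_mem hd hdn hj
  obtain ⟨a, ha, rfl⟩ := Finset.mem_map.1 hj
  have h := div_ne_of_mem_familyHelpers (lt_groupSize hd hdn _) ha
  rw [familyOf, familyOf, hg]
  simpa using h

/-- Nodes that help one another are in the same group and in different families, so that their number
is at most the number of families of the group. -/
theorem exists_mul_lt_groupSize {n d M : ℕ} (hd : 1 ≤ d) (hdn : d < n) {ι : Type*} (C : Finset ι)
    (p : ι → Fin n) (hM : C.card = M) (hM1 : 1 ≤ M)
    (hC : ∀ x ∈ C, ∀ y ∈ C, x ≠ y → (p y : ℕ) ∈ familyPlusHelpers n d (p x) ∨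
      (p x : ℕ) ∈ familyPlusHelpers n d (p y)) :
    ∃ i < n, (M - 1) * (groupSize n d (groupOf n d i) - d) < groupSize n d (groupOf n d i) := by
  obtain ⟨x₀, hx₀⟩ := Finset.card_pos.1 (by omega : 0 < C.card)
  refine ⟨p x₀, (p x₀).isLt, ?_⟩
  set N := groupSize n d (groupOf n d (p x₀)) with hN
  have hdN : d < N := lt_groupSize hd hdn _
  have hgroup : ∀ x ∈ C, groupOf n d (p x) = groupOf n d (p x₀) := by
    intro x hx
    by_cases h : x = x₀
    · rw [h]
    · rcases hC x hx x₀ hx₀ h with h | h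
      · exact (groupOf_eq_of_mem hd hdn h).symm
      · exact groupOf_eq_of_mem hd hdn h
  have hle : C.card ≤ (Finset.range ((N - 1) / (N - d) + 1)).card := by
    refine Finset.card_le_card_of_injOn (fun x => familyOf n d (p x)) ?_ ?_
    · intro x hx
      have h := sub_lt_groupSize hd (p x).isLt
      simp only [Finset.coe_range, Set.mem_Iio, Nat.lt_succ_iff, familyOf]
      rw [hgroup x hx, ← hN] at h ⊢
      exact Nat.div_le_div_right (by omega)
    · intro x hx y hy hxy
      by_contra hne
      rcases hC x hx y hy hne with h | h
      · exact familyOf_ne_of_mem hd hdn h hxy.symm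
      · exact familyOf_ne_of_mem hd hdn h hxy
  rw [Finset.card_range, hM] at hle
  have h1 : M - 1 ≤ (N - 1) / (N - d) := by omega
  rw [Nat.le_div_iff_mul_le (by omega)] at h1
  omega

theorem groupSize_eq_or {n d : ℕ} (hd : 1 ≤ d) (i : ℕ) :
    groupSize n d (groupOf n d i) = n ∨ 2 * d ≤ groupSize n d (groupOf n d i) ∧ 2 * d ≤ n := by
  unfold groupSize numGroups
  rcases Nat.lt_or_ge n (2 * d) with h | h
  · left
    simp [Nat.div_eq_of_lt h]
  · right
    refine ⟨?_, h⟩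
    split_ifs
    · exact le_rfl
    · have h1 := Nat.mul_div_le n (2 * d)
      have hpos : 1 ≤ n / (2 * d) := (Nat.le_div_iff_mul_le (by omega)).2 (by omega)
      rw [max_eq_right hpos, Nat.mul_sub]
      have h2 : 2 * d * 1 ≤ 2 * d * (n / (2 * d)) := Nat.mul_le_mul_left _ hpos
      omega

theorem groupSize_one_le (n b : ℕ) : groupSize n 1 b ≤ 2 + n % 2 := by
  unfold groupSize numGroups
  split_ifs
  · omega
  · omega

theorem mem_familyPlusHelpers_of_mem_ifgs {n d : ℕ} (hd : 1 ≤ d) (hdn : d < n) {G : IFG n d}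
    (hG : G ∈ (familyPlusScheme n d hd hdn).toHelperScheme.ifgs) {l : Fin G.numRepairs}
    {x : StorageNode n G.numRepairs} (hx : x ∈ G.helperNodes l) :
    (physicalNode G.failed x : ℕ) ∈
      familyPlusHelpers n d (physicalNode G.failed (Sum.inr l)) := by
  have h := G.physicalNode_mem_helpers hx
  rw [hG l] at h
  exact Finset.mem_attachFin _ |>.1 h

/-- For `d ≥ 2`, the oldest elements of a set that attains the general lower bound would be more
nodes that help one another than there are families in a group. -/
theorem exists_lt_minMinCut_familyPlus {n k d : ℕ} (hk : 1 ≤ k) (hkn : k ≤ n - 1) (hd : 2 ≤ d)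
    (hdn : d < n) (h : n ≤ (k - 1) * (n - d)) :
    ∃ α β : ℝ≥0, 0 < α ∧ 0 < β ∧
      ∑ i ∈ Finset.range k, min (((d - i : ℕ) : ℝ≥0∞) * (β : ℝ≥0∞)) (α : ℝ≥0∞)
        < minMinCut (familyPlusScheme n d (by omega) hdn).toHelperScheme.ifgs k α β := by
  refine exists_lt_minMinCut fun G hG t W hW htight => ?_
  have hd1 : 1 ≤ d := by omega
  have hkW := G.le_card_of_activeNode_mem hW
  obtain ⟨i, hi, hlt⟩ := exists_mul_lt_groupSize hd1 hdn
    {x ∈ W | (olderIn W x).card < min k (d + 1)} (physicalNode G.failed)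
    (card_filter_card_olderIn_lt W ((min_le_left _ _).trans hkW)) (by omega) (by
      have key : ∀ x ∈ {x ∈ W | (olderIn W x).card < min k (d + 1)}, ∀ y ∈ W,
          birth y < birth x →
          (physicalNode G.failed y : ℕ) ∈ familyPlusHelpers n d (physicalNode G.failed x) := by
        intro x hx y hy hyx
        obtain ⟨hxW, hxM⟩ := Finset.mem_filter.1 hx
        obtain ⟨l, rfl, hl⟩ := htight x hxW
        exact mem_familyPlusHelpers_of_mem_ifgs hd1 hdn hG
          (G.mem_helperNodes_of_tight hl hxM hy hyx)
      intro x hx y hy hxy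
      rcases lt_or_gt_of_ne (birth_injective.ne hxy) with hlt | hlt
      · exact Or.inr (key y hy x (Finset.mem_filter.1 hx).1 hlt)
      · exact Or.inl (key x hx y (Finset.mem_filter.1 hy).1 hlt))
  have hk3 : 3 ≤ k := by
    by_contra hk2
    have : (k - 1) * (n - d) ≤ 1 * (n - d) := Nat.mul_le_mul_right _ (by omega)
    omega
  rcases groupSize_eq_or (n := n) hd1 i with hN | ⟨hN, -⟩
  · rw [hN] at hlt
    rcases le_total k (d + 1) with hkd | hkd
    · rw [min_eq_left hkd] at hlt
      omega
    · -- here `d + 2 ≤ n`, because `d + 1 ≤ k ≤ n - 1`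
      rw [min_eq_right hkd, Nat.add_sub_cancel] at hlt
      obtain ⟨e, rfl⟩ : ∃ e, n = d + 2 + e := ⟨n - d - 2, by omega⟩
      rw [show d + 2 + e - d = 2 + e by omega] at hlt
      nlinarith
  · generalize groupSize n d (groupOf n d i) = N at hlt hN
    have : 2 * (N - d) ≤ (min k (d + 1) - 1) * (N - d) := Nat.mul_le_mul_right _ (by omega)
    omega

/-- For `d = 1`, a set that attains the general lower bound is a tree of newcomers, which stays
inside one group. -/
theorem exists_lt_minMinCut_familyPlus_one {n k : ℕ} (hn : 1 < n) (h : 2 + n % 2 < k) :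
    ∃ α β : ℝ≥0, 0 < α ∧ 0 < β ∧
      ∑ i ∈ Finset.range k, min (((1 - i : ℕ) : ℝ≥0∞) * (β : ℝ≥0∞)) (α : ℝ≥0∞)
        < minMinCut (familyPlusScheme n 1 le_rfl hn).toHelperScheme.ifgs k α β := by
  refine exists_lt_minMinCut fun G hG t W hW htight => ?_
  have hkW := G.le_card_of_activeNode_mem hW
  obtain ⟨x₀, hx₀, hmin⟩ := Finset.exists_min_image W birth
    (Finset.card_pos.1 (by omega : 0 < W.card))
  set g := groupOf n 1 (physicalNode G.failed x₀) with hg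
  have hgroup : ∀ b, ∀ x ∈ W, birth x = b → groupOf n 1 (physicalNode G.failed x) = g := by
    intro b
    induction b using Nat.strong_induction_on with
    | _ b ih =>
    rintro x hx rfl
    by_cases hxx : x = x₀
    · rw [hxx]
    obtain ⟨l, rfl, hl⟩ := htight x hx
    have hold : x₀ ∈ olderIn W (Sum.inr l) := Finset.mem_filter.2
      ⟨hx₀, lt_of_le_of_ne (hmin _ hx) (birth_injective.ne (Ne.symm hxx))⟩
    have hpos := Finset.card_pos.2 ⟨x₀, hold⟩
    have hzero : (G.helperNodes l \ W).card = 0 := by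
      rw [hl]
      split_ifs <;> omega
    rw [Finset.card_eq_zero, Finset.sdiff_eq_empty_iff_subset] at hzero
    obtain ⟨y, hy⟩ := Finset.card_pos.1 (by rw [G.card_helperNodes]; exact one_pos :
      0 < (G.helperNodes l).card)
    rw [← ih _ (G.birth_lt_of_mem_helperNodes hy) y (hzero hy) rfl]
    exact (groupOf_eq_of_mem le_rfl hn (mem_familyPlusHelpers_of_mem_ifgs le_rfl hn hG hy)).symm
  have hle : t.1.card ≤ (Finset.range (groupSize n 1 g)).card := by
    have htg : ∀ i ∈ t.1, groupOf n 1 i = g := fun i hi => by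
      have := hgroup _ _ (hW i hi) rfl
      rwa [physicalNode_activeNode] at this
    refine Finset.card_le_card_of_injOn (fun i => (i : ℕ) - 2 * 1 * g) ?_ ?_
    · intro i hi
      have := sub_lt_groupSize (n := n) (d := 1) le_rfl i.isLt
      rw [htg i hi] at this
      simpa using this
    · intro i hi j hj hij
      have h1 := group_start_le n 1 i
      have h2 := group_start_le n 1 j
      rw [htg i hi] at h1
      rw [htg j hj] at h2
      simp only at hij
      exact Fin.ext (by omega)
  rw [t.2, Finset.card_range] at hle
  have := groupSize_one_le n g
  omega

/-! ### The condition on the parameters -/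

theorem le_ceil_div_iff {n k d : ℕ} (hk : 1 ≤ k) (hdn : d < n) :
    (k : ℤ) ≤ ⌈(n : ℚ) / ((n : ℚ) - (d : ℚ))⌉ ↔ (k - 1) * (n - d) < n := by
  have hpos : (0 : ℚ) < (n : ℚ) - d := sub_pos.2 (by exact_mod_cast hdn)
  rw [Int.le_ceil_iff, lt_div_iff₀ hpos, ← Nat.cast_sub hdn.le, Int.cast_natCast,
    ← Nat.cast_one, ← Nat.cast_sub hk]
  exact_mod_cast Iff.rfl

theorem minMinCut_eq_sum {n k d : ℕ} (hk : 1 ≤ k) (hdn : d < n)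
    (h : (d = 1 ∧ k = 3 ∧ Odd n) ∨ (k : ℤ) ≤ ⌈(n : ℚ) / ((n : ℚ) - (d : ℚ))⌉)
    (A : HelperScheme n d) (α β : ℝ≥0∞) :
    minMinCut A.ifgs k α β
      = ∑ i ∈ Finset.range k, min (((d - i : ℕ) : ℝ≥0∞) * β) α := by
  refine le_antisymm ?_ (sum_le_minMinCut _ k α β)
  rcases h with ⟨rfl, rfl, hn⟩ | h
  · refine (minMinCut_three_le hn A α β).trans ?_
    simp [Finset.sum_range_succ]
  · exact minMinCut_le_of_mul_lt hk hdn ((le_ceil_div_iff hk hdn).1 h) A α β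

end DistributedStorage

open DistributedStorage in
theorem mainTheorem1 (n k d : ℕ) (hn : 2 ≤ n) (hk : 1 ≤ k) (hkn : k ≤ n - 1)
    (hd : 1 ≤ d) (hdn : d < n) :
    -- the min-cut value of blind helper selection; `d - i` is truncated at `0`
    (∀ α β : ℝ≥0∞, minMinCut (blindIFGs n d) k α β
        = ∑ i ∈ Finset.range k, min (((d - i : ℕ) : ℝ≥0∞) * β) α) ∧
    -- the converse
    ((d = 1 ∧ k = 3 ∧ Odd n) ∨ (k : ℤ) ≤ ⌈(n : ℚ) / ((n : ℚ) - (d : ℚ))⌉ →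
      (∀ (A : HelperScheme n d) (α β : ℝ≥0∞), minMinCut A.ifgs k α β
        = ∑ i ∈ Finset.range k, min (((d - i : ℕ) : ℝ≥0∞) * β) α) ∧
      IsAbsolutelyOptimal (blindIFGs n d) k) ∧
    -- the achievability
    (¬ ((d = 1 ∧ k = 3 ∧ Odd n) ∨ (k : ℤ) ≤ ⌈(n : ℚ) / ((n : ℚ) - (d : ℚ))⌉) →
      ∃ α β : ℝ≥0, 0 < α ∧ 0 < β ∧
        ∑ i ∈ Finset.range k, min (((d - i : ℕ) : ℝ≥0∞) * (β : ℝ≥0∞)) (α : ℝ≥0∞)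
          < minMinCut (familyPlusScheme n d hd hdn).toHelperScheme.ifgs k α β) := by
  have hsum := fun α β => minMinCut_blindIFGs (k := k) (by omega) hdn α β
  refine ⟨hsum, fun h => ⟨minMinCut_eq_sum hk hdn h, fun B α β => ?_⟩, fun h => ?_⟩
  · rw [minMinCut_eq_sum hk hdn h, hsum]
  · rw [not_or, le_ceil_div_iff hk hdn, not_lt] at h
    obtain ⟨h1, h2⟩ := h
    obtain hd2 | rfl : 2 ≤ d ∨ d = 1 := by omega
    · exact exists_lt_minMinCut_familyPlus hk hkn hd2 hdn h2
    · refine exists_lt_minMinCut_familyPlus_one hdn ?_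
      have hk3 : 3 ≤ k := by
        by_contra hk2
        have : (k - 1) * (n - 1) ≤ 1 * (n - 1) := Nat.mul_le_mul_right _ (by omega)
        omega
      rcases Nat.even_or_odd n with hn2 | hn2
      · rw [Nat.even_iff.1 hn2]
        omega
      · rw [Nat.odd_iff.1 hn2]
        have : k ≠ 3 := fun h => h1 ⟨rfl, h, hn2⟩
        omega
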